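/- Let $p$ be a prime, let $\mathbb F_q$ be a finite field with $q$ elements and of characteristic $p$, and let $k\ge 1$ and $n\ge 2$ be integers. If $p\nmid k$ and $q\ge k^3-3k^2+3k$, then every matrix $A\in M_n(\mathbb F_q)$ is a sum of two $k$-th powers, i.e., there exist $B,C\in M_n(\mathbb F_q)$ such that $A=B^k+C^k$. -/

import Mathlib

/-!
Expanding the number of representations of `a ≠ 0` as a sum of `k`-th powers in multiplicative
characters killed by `k` and bounding the resulting Jacobi sums shows that `a` is a sum of three
`k`-th powers when `(k - 1) ^ 3 < q`, and of two when `(k - 1) ^ 4 < q`.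

A nonscalar matrix is conjugate to one whose diagonal is any prescribed vector of the right trace.
The three-powers statement makes it possible to write such a vector as `β i ^ k + γ i ^ k` with `β`
and `γ` vanishing at most once each. The matrix then splits into a lower triangular one with
diagonal `β i ^ k` and an upper triangular one with diagonal `γ i ^ k`. Each has a `k`-th root that
is a polynomial in it: modulo the characteristic polynomial, Newton's method lifts a root at every
nonzero eigenvalue, while the eigenvalue `0` is at most simple.

A scalar matrix lies in a copy of the field with `q ^ n` elements inside the matrix algebra, and
`(k - 1) ^ 4 < q ^ n`, so two powers suffice there.
-/

section AdditiveConvolution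

variable {G R : Type*} [AddGroup G] [Fintype G] [Semiring R]

/-- The additive convolution of two functions on a finite group, written as a finite sum so that no
summability enters. -/
def addConv (f g : G → R) (b : G) : R := ∑ x, f x * g (b - x)

theorem exists_add_eq_of_addConv_ne_zero {f g : G → R} {b : G} (h : addConv f g b ≠ 0) :
    ∃ x y, y + x = b ∧ f x ≠ 0 ∧ g y ≠ 0 := by
  obtain ⟨x, -, hx⟩ := Finset.exists_ne_zero_of_sum_ne_zero h
  exact ⟨x, b - x, sub_add_cancel b x, left_ne_zero_of_mul hx, right_ne_zero_of_mul hx⟩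

theorem sum_addConv (f g : G → R) : ∑ b, addConv f g b = (∑ x, f x) * ∑ y, g y := by
  simp_rw [addConv, Finset.sum_mul]
  rw [Finset.sum_comm]
  refine Finset.sum_congr rfl fun x _ => ?_
  rw [← Finset.mul_sum]
  exact congrArg _ (Equiv.sum_comp (Equiv.subRight x) g)

theorem addConv_const_add_const_add {f g : G → R} (hf : ∑ x, f x = 0) (hg : ∑ y, g y = 0)
    (a b : R) :
    addConv (fun x => a + f x) (fun y => b + g y)
      = fun c => Fintype.card G • (a * b) + addConv f g c := by
  ext c
  have hg' : ∑ x, g (c - x) = 0 := (Equiv.sum_comp (Equiv.subLeft c) g).trans hg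
  simp only [addConv, add_mul, mul_add, Finset.sum_add_distrib, ← Finset.mul_sum, ← Finset.sum_mul,
    hf, hg', Finset.sum_const, Finset.card_univ, mul_smul_comm, mul_zero, zero_mul, add_zero,
    zero_add]

theorem addConv_sum_left {ι : Type*} (s : Finset ι) (f : ι → G → R) (g : G → R) :
    addConv (∑ i ∈ s, f i) g = ∑ i ∈ s, addConv (f i) g := by
  ext b
  simp only [addConv, Finset.sum_apply, Finset.sum_mul]
  exact Finset.sum_comm

theorem addConv_sum_right {ι : Type*} (s : Finset ι) (f : G → R) (g : ι → G → R) :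
    addConv f (∑ i ∈ s, g i) = ∑ i ∈ s, addConv f (g i) := by
  ext b
  simp only [addConv, Finset.sum_apply, Finset.mul_sum]
  exact Finset.sum_comm

end AdditiveConvolution

section JacobiSums

variable {F : Type*} [Field F]

section Domain

variable [Fintype F] {R : Type*} [CommRing R]

theorem addConv_mulChar_of_ne_zero (χ ψ : MulChar F R) {b : F} (hb : b ≠ 0) :
    addConv χ ψ b = jacobiSum χ ψ * (χ * ψ) b := by
  rw [jacobiSum, addConv, ← Equiv.sum_comp (Equiv.mulLeft₀ b hb), Finset.sum_mul]
  refine Finset.sum_congr rfl fun y _ => ?_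
  rw [Equiv.mulLeft₀_apply, ← mul_one_sub, map_mul, map_mul, MulChar.mul_apply]
  ring

theorem addConv_mulChar_zero (χ ψ : MulChar F R) :
    addConv χ ψ 0 = ψ (-1) * ∑ y, (χ * ψ) y := by
  rw [addConv, Finset.mul_sum]
  refine Finset.sum_congr rfl fun y _ => ?_
  rw [zero_sub, neg_eq_neg_one_mul, map_mul, MulChar.mul_apply]
  ring

variable [IsDomain R]

theorem addConv_mulChar_of_mul_ne_one {χ ψ : MulChar F R} (h : χ * ψ ≠ 1) :
    addConv χ ψ = fun b => jacobiSum χ ψ * (χ * ψ) b := by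
  ext b
  rcases eq_or_ne b 0 with rfl | hb
  · rw [addConv_mulChar_zero, MulChar.sum_eq_zero_of_ne_one h, MulChar.map_zero, mul_zero, mul_zero]
  · exact addConv_mulChar_of_ne_zero χ ψ hb

theorem addConv_mulChar_inv [DecidableEq F] {χ : MulChar F R} (hχ : χ ≠ 1) (b : F) :
    addConv χ (χ⁻¹ : MulChar F R) b
      = χ (-1) * ((if b = 0 then (Fintype.card F : R) else 0) - 1) := by
  rcases eq_or_ne b 0 with rfl | hb
  · rw [addConv_mulChar_zero, mul_inv_cancel, MulChar.sum_one_eq_card_units, MulChar.inv_apply',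
      inv_neg_one, if_pos rfl, Fintype.card_units, Nat.cast_pred Fintype.card_pos]
  · rw [addConv_mulChar_of_ne_zero _ _ hb, mul_inv_cancel, MulChar.one_apply hb.isUnit,
      jacobiSum_nontrivial_inv hχ, if_neg hb]
    ring

theorem addConv_addConv_mulChar_inv {φ χ : MulChar F R} (hφ : φ ≠ 1) (hχ : χ ≠ 1) (a : F) :
    addConv φ (addConv χ (χ⁻¹ : MulChar F R)) a = χ (-1) * (Fintype.card F * φ a) := by
  classical
  have hterm (x : F) : φ x * addConv χ (χ⁻¹ : MulChar F R) (a - x)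
      = χ (-1) * ((if a = x then Fintype.card F * φ x else 0) - φ x) := by
    rw [addConv_mulChar_inv hχ, sub_eq_zero]
    split_ifs <;> ring
  rw [addConv, Finset.sum_congr rfl fun x _ => hterm x, ← Finset.mul_sum, Finset.sum_sub_distrib,
    MulChar.sum_eq_zero_of_ne_one hφ, Finset.sum_ite_eq, if_pos (Finset.mem_univ a), sub_zero]

end Domain

theorem norm_mulChar_apply_le_one [Finite F] (χ : MulChar F ℂ) (y : F) : ‖χ y‖ ≤ 1 := by
  have := Fintype.ofFinite Fˣ
  rcases eq_or_ne y 0 with rfl | hy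
  · rw [MulChar.map_zero, norm_zero]
    exact zero_le_one
  · exact (Complex.norm_eq_one_of_mem_rootsOfUnity (χ.apply_mem_rootsOfUnity (Units.mk0 y hy))).le

variable [Fintype F]

theorem norm_jacobiSum_eq_sqrt {χ ψ : MulChar F ℂ} (hχ : χ ≠ 1) (hψ : ψ ≠ 1) (h : χ * ψ ≠ 1) :
    ‖jacobiSum χ ψ‖ = √(Fintype.card F) := by
  have hchar : ringChar ℂ ≠ ringChar F := by
    rw [ringChar.eq_zero]
    exact (CharP.ringChar_ne_zero_of_finite F).symm
  have hstar : jacobiSum χ⁻¹ ψ⁻¹ = star (jacobiSum χ ψ) := by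
    simp [jacobiSum, ← MulChar.star_apply']
  have hnorm := congrArg norm (jacobiSum_mul_jacobiSum_inv hchar hχ hψ h)
  rw [hstar, norm_mul, norm_star, Complex.norm_natCast] at hnorm
  rw [← hnorm, Real.sqrt_mul_self (norm_nonneg _)]

theorem norm_jacobiSum_le_sqrt {χ ψ : MulChar F ℂ} (hχ : χ ≠ 1) (hψ : ψ ≠ 1) :
    ‖jacobiSum χ ψ‖ ≤ √(Fintype.card F) := by
  by_cases h : χ * ψ = 1
  · rw [← inv_eq_of_mul_eq_one_right h, jacobiSum_nontrivial_inv hχ, norm_neg]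
    exact (norm_mulChar_apply_le_one χ _).trans
      (Real.one_le_sqrt.2 (Nat.one_le_cast.2 Fintype.card_pos))
  · exact (norm_jacobiSum_eq_sqrt hχ hψ h).le

theorem norm_addConv_mulChar_le {χ ψ : MulChar F ℂ} (hχ : χ ≠ 1) (hψ : ψ ≠ 1) {a : F}
    (ha : a ≠ 0) : ‖addConv χ ψ a‖ ≤ √(Fintype.card F) := by
  rw [addConv_mulChar_of_ne_zero χ ψ ha, norm_mul]
  exact (mul_le_of_le_one_right (norm_nonneg _) (norm_mulChar_apply_le_one _ a)).trans
    (norm_jacobiSum_le_sqrt hχ hψ)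

theorem norm_addConv_addConv_mulChar_le {φ χ ψ : MulChar F ℂ} (hφ : φ ≠ 1) (hχ : χ ≠ 1)
    (hψ : ψ ≠ 1) {a : F} (ha : a ≠ 0) :
    ‖addConv φ (addConv χ ψ) a‖ ≤ Fintype.card F := by
  by_cases h : χ * ψ = 1
  · rw [← inv_eq_of_mul_eq_one_right h, addConv_addConv_mulChar_inv hφ hχ, norm_mul, norm_mul,
      Complex.norm_natCast]
    calc ‖χ (-1)‖ * (Fintype.card F * ‖φ a‖) ≤ 1 * (Fintype.card F * 1) := by
          gcongr <;> exact norm_mulChar_apply_le_one _ _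
      _ = Fintype.card F := by ring
  · have hpull : addConv φ (addConv χ ψ) a = jacobiSum χ ψ * addConv φ (χ * ψ : MulChar F ℂ) a := by
      rw [addConv_mulChar_of_mul_ne_one h]
      simp only [addConv, Finset.mul_sum, mul_left_comm]
    rw [hpull, norm_mul]
    calc ‖jacobiSum χ ψ‖ * ‖addConv φ (χ * ψ : MulChar F ℂ) a‖
        ≤ √(Fintype.card F) * √(Fintype.card F) := by
          gcongr
          · exact norm_jacobiSum_le_sqrt hχ hψ
          · exact norm_addConv_mulChar_le hφ h ha
      _ = Fintype.card F := Real.mul_self_sqrt (Nat.cast_nonneg _)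

end JacobiSums

section PowerSums

variable {F : Type*} [Field F]

/-- The complex multiplicative characters of a finite field that are killed by `k`. They detect the
`k`-th powers among the nonzero elements. -/
noncomputable def torsionMulChars (F : Type*) [Field F] [Finite F] (k : ℕ) :
    Finset (MulChar F ℂ) :=
  (Set.toFinite {χ : MulChar F ℂ | χ ^ k = 1}).toFinset

theorem mem_torsionMulChars [Finite F] {k : ℕ} {χ : MulChar F ℂ} :
    χ ∈ torsionMulChars F k ↔ χ ^ k = 1 := by
  simp [torsionMulChars]

theorem card_torsionMulChars_le [Finite F] {k : ℕ} (hk : k ≠ 0) :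
    (torsionMulChars F k).card ≤ k := by
  classical
  have : Fintype (MulChar F ℂ) := Fintype.ofFinite _
  obtain ⟨e⟩ := MulChar.mulEquiv_units F ℂ
  have : IsCyclic (MulChar F ℂ) := isCyclic_of_surjective e.symm e.symm.surjective
  convert IsCyclic.card_pow_eq_one_le (α := MulChar F ℂ) hk.bot_lt using 2
  ext χ
  simp [mem_torsionMulChars]

theorem exists_mulChar_pow_eq_one_apply_ne_one [Finite F] {k : ℕ} {y : Fˣ}
    (hy : ¬∃ x : Fˣ, x ^ k = y) : ∃ χ : MulChar F ℂ, χ ^ k = 1 ∧ χ y ≠ 1 := by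
  let H : Subgroup Fˣ := (powMonoidHom k : Fˣ →* Fˣ).range
  have hyH : (y : Fˣ ⧸ H) ≠ 1 := mt (QuotientGroup.eq_one_iff y).1 hy
  obtain ⟨φ, hφ⟩ := CommGroup.exists_apply_ne_one_of_hasEnoughRootsOfUnity (Fˣ ⧸ H) ℂ hyH
  refine ⟨MulChar.ofUnitHom (φ.comp (QuotientGroup.mk' H)), ?_, by simpa using hφ⟩
  ext u
  have hu : (u : Fˣ ⧸ H) ^ k = 1 := by
    rw [← QuotientGroup.mk_pow, QuotientGroup.eq_one_iff]
    exact ⟨u, rfl⟩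
  rw [MulChar.pow_apply_coe, MulChar.ofUnitHom_coe, MulChar.one_apply_coe,
    ← Units.val_pow_eq_pow_val]
  simp [← map_pow, hu]

theorem sum_torsionMulChars_eq_zero [Finite F] {k : ℕ} {y : Fˣ} (hy : ¬∃ x : Fˣ, x ^ k = y) :
    ∑ ψ ∈ torsionMulChars F k, ψ y = 0 := by
  obtain ⟨χ, hχk, hχy⟩ := exists_mulChar_pow_eq_one_apply_ne_one hy
  have hinv : χ y * ∑ ψ ∈ torsionMulChars F k, ψ y = ∑ ψ ∈ torsionMulChars F k, ψ y := by
    rw [Finset.mul_sum]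
    refine Finset.sum_equiv (Equiv.mulLeft χ) (fun ψ => ?_) fun ψ _ => by simp
    simp [mem_torsionMulChars, mul_pow, hχk]
  exact (mul_left_eq_self₀.1 hinv).resolve_left hχy

/-- The nontrivial complex multiplicative characters of a finite field that are killed by `k`. -/
noncomputable def nontrivialTorsionMulChars (F : Type*) [Field F] [Finite F] (k : ℕ) :
    Finset (MulChar F ℂ) :=
  (Set.toFinite {χ : MulChar F ℂ | χ ^ k = 1 ∧ χ ≠ 1}).toFinset

theorem mem_nontrivialTorsionMulChars [Finite F] {k : ℕ} {χ : MulChar F ℂ} :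
    χ ∈ nontrivialTorsionMulChars F k ↔ χ ^ k = 1 ∧ χ ≠ 1 := by
  simp [nontrivialTorsionMulChars]

theorem ne_one_of_mem_nontrivialTorsionMulChars [Finite F] {k : ℕ} {χ : MulChar F ℂ}
    (hχ : χ ∈ nontrivialTorsionMulChars F k) : χ ≠ 1 :=
  (mem_nontrivialTorsionMulChars.1 hχ).2

theorem cons_one_nontrivialTorsionMulChars (F : Type*) [Field F] [Finite F] (k : ℕ) :
    (nontrivialTorsionMulChars F k).cons 1 (by simp [mem_nontrivialTorsionMulChars])
      = torsionMulChars F k := by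
  ext χ
  by_cases hχ : χ = 1 <;> simp [mem_nontrivialTorsionMulChars, mem_torsionMulChars, hχ]

theorem card_nontrivialTorsionMulChars_le [Finite F] {k : ℕ} (hk : k ≠ 0) :
    (nontrivialTorsionMulChars F k).card ≤ k - 1 := by
  have hcard := card_torsionMulChars_le (F := F) hk
  rw [← cons_one_nontrivialTorsionMulChars, Finset.card_cons] at hcard
  exact Nat.le_sub_one_of_lt hcard

/-- The sum of the nontrivial characters killed by `k`. For `k ≠ 0` the number of solutions of
`x ^ k = y` is `1 + torsionCharSum F k y`, also for `y = 0`, which is why the trivial character,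
vanishing at `0`, is replaced by the constant `1`. -/
noncomputable def torsionCharSum (F : Type*) [Field F] [Finite F] (k : ℕ) : F → ℂ :=
  ∑ χ ∈ nontrivialTorsionMulChars F k, χ

theorem exists_pow_eq_of_one_add_torsionCharSum_ne_zero [Finite F] {k : ℕ} (hk : k ≠ 0) {y : F}
    (h : 1 + torsionCharSum F k y ≠ 0) : ∃ x, x ^ k = y := by
  rcases eq_or_ne y 0 with rfl | hy
  · exact ⟨0, zero_pow hk⟩
  lift y to Fˣ using hy.isUnit
  contrapose! h
  have hsum := sum_torsionMulChars_eq_zero (k := k) (y := y)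
    fun ⟨x, hx⟩ => h x (by rw [← hx, Units.val_pow_eq_pow_val])
  rw [← cons_one_nontrivialTorsionMulChars, Finset.sum_cons, MulChar.one_apply_coe] at hsum
  rwa [torsionCharSum, Finset.sum_apply]

variable [Fintype F]

theorem sum_torsionCharSum (k : ℕ) : ∑ y, torsionCharSum F k y = 0 := by
  simp_rw [torsionCharSum, Finset.sum_apply]
  rw [Finset.sum_comm]
  exact Finset.sum_eq_zero fun χ hχ =>
    MulChar.sum_eq_zero_of_ne_one (ne_one_of_mem_nontrivialTorsionMulChars hχ)

theorem norm_addConv_torsionCharSum_le {k : ℕ} (hk : k ≠ 0) {a : F} (ha : a ≠ 0) :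
    ‖addConv (torsionCharSum F k) (torsionCharSum F k) a‖
      ≤ ((k - 1 : ℕ) : ℝ) ^ 2 * √(Fintype.card F) := by
  let T := nontrivialTorsionMulChars F k
  have hexpand : addConv (torsionCharSum F k) (torsionCharSum F k) a
      = ∑ χ ∈ T, ∑ ψ ∈ T, addConv χ ψ a := by
    simp_rw [torsionCharSum, addConv_sum_left, addConv_sum_right, Finset.sum_apply, T]
  calc ‖addConv (torsionCharSum F k) (torsionCharSum F k) a‖
      ≤ ∑ _ ∈ T, ∑ _ ∈ T, √(Fintype.card F) := hexpand ▸
        norm_sum_le_of_le _ fun _ hχ => norm_sum_le_of_le _ fun _ hψ =>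
          norm_addConv_mulChar_le (ne_one_of_mem_nontrivialTorsionMulChars hχ)
            (ne_one_of_mem_nontrivialTorsionMulChars hψ) ha
    _ = (T.card : ℝ) ^ 2 * √(Fintype.card F) := by
        simp only [Finset.sum_const, nsmul_eq_mul]
        ring
    _ ≤ ((k - 1 : ℕ) : ℝ) ^ 2 * √(Fintype.card F) := by
        gcongr
        exact card_nontrivialTorsionMulChars_le hk

theorem norm_addConv_addConv_torsionCharSum_le {k : ℕ} (hk : k ≠ 0) {a : F} (ha : a ≠ 0) :
    ‖addConv (torsionCharSum F k) (addConv (torsionCharSum F k) (torsionCharSum F k)) a‖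
      ≤ ((k - 1 : ℕ) : ℝ) ^ 3 * Fintype.card F := by
  let T := nontrivialTorsionMulChars F k
  have hexpand :
      addConv (torsionCharSum F k) (addConv (torsionCharSum F k) (torsionCharSum F k)) a
        = ∑ φ ∈ T, ∑ χ ∈ T, ∑ ψ ∈ T, addConv φ (addConv χ ψ) a := by
    simp_rw [torsionCharSum, addConv_sum_left, addConv_sum_right, Finset.sum_apply, T]
  calc ‖addConv (torsionCharSum F k) (addConv (torsionCharSum F k) (torsionCharSum F k)) a‖
      ≤ ∑ _ ∈ T, ∑ _ ∈ T, ∑ _ ∈ T, (Fintype.card F : ℝ) := hexpand ▸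
        norm_sum_le_of_le _ fun _ hφ => norm_sum_le_of_le _ fun _ hχ =>
          norm_sum_le_of_le _ fun _ hψ =>
            norm_addConv_addConv_mulChar_le (ne_one_of_mem_nontrivialTorsionMulChars hφ)
              (ne_one_of_mem_nontrivialTorsionMulChars hχ)
              (ne_one_of_mem_nontrivialTorsionMulChars hψ) ha
    _ = (T.card : ℝ) ^ 3 * Fintype.card F := by
        simp only [Finset.sum_const, nsmul_eq_mul]
        ring
    _ ≤ ((k - 1 : ℕ) : ℝ) ^ 3 * Fintype.card F := by
        gcongr
        exact card_nontrivialTorsionMulChars_le hk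

theorem addConv_one_add_torsionCharSum (k : ℕ) :
    addConv (fun y => 1 + torsionCharSum F k y) (fun y => 1 + torsionCharSum F k y)
      = fun b => (Fintype.card F : ℂ) + addConv (torsionCharSum F k) (torsionCharSum F k) b := by
  simpa using addConv_const_add_const_add (sum_torsionCharSum (F := F) k) (sum_torsionCharSum k) 1 1

theorem addConv_addConv_one_add_torsionCharSum (k : ℕ) :
    addConv (fun y => 1 + torsionCharSum F k y)
        (addConv (fun y => 1 + torsionCharSum F k y) fun y => 1 + torsionCharSum F k y)
      = fun b => (Fintype.card F : ℂ) ^ 2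
        + addConv (torsionCharSum F k) (addConv (torsionCharSum F k) (torsionCharSum F k)) b := by
  have hsum : ∑ b, addConv (torsionCharSum F k) (torsionCharSum F k) b = 0 := by
    rw [sum_addConv, sum_torsionCharSum, zero_mul]
  rw [addConv_one_add_torsionCharSum, addConv_const_add_const_add (sum_torsionCharSum k) hsum]
  simp [sq]

theorem exists_pow_add_pow_eq {k : ℕ} (hk : k ≠ 0) (hq : (k - 1) ^ 4 < Fintype.card F) {a : F}
    (ha : a ≠ 0) : ∃ x y : F, x ^ k + y ^ k = a := by
  have hsmall : ‖addConv (torsionCharSum F k) (torsionCharSum F k) a‖ < ‖(Fintype.card F : ℂ)‖ := by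
    have hsqrt : ((k - 1 : ℕ) : ℝ) ^ 2 < √(Fintype.card F) :=
      Real.lt_sqrt_of_sq_lt (by rw [← pow_mul]; exact_mod_cast hq)
    calc ‖addConv (torsionCharSum F k) (torsionCharSum F k) a‖
        ≤ ((k - 1 : ℕ) : ℝ) ^ 2 * √(Fintype.card F) := norm_addConv_torsionCharSum_le hk ha
      _ < √(Fintype.card F) * √(Fintype.card F) := by gcongr
      _ = ‖(Fintype.card F : ℂ)‖ := by
          rw [Real.mul_self_sqrt (Nat.cast_nonneg _), Complex.norm_natCast]
  have hcount : addConv (fun y => 1 + torsionCharSum F k y)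
      (fun y => 1 + torsionCharSum F k y) a ≠ 0 := by
    rw [addConv_one_add_torsionCharSum]
    exact fun h => hsmall.ne' (by rw [eq_neg_of_add_eq_zero_left h, norm_neg])
  obtain ⟨u, v, rfl, hu, hv⟩ := exists_add_eq_of_addConv_ne_zero hcount
  obtain ⟨x, rfl⟩ := exists_pow_eq_of_one_add_torsionCharSum_ne_zero hk hu
  obtain ⟨y, rfl⟩ := exists_pow_eq_of_one_add_torsionCharSum_ne_zero hk hv
  exact ⟨y, x, rfl⟩

theorem exists_pow_add_pow_add_pow_eq {k : ℕ} (hk : k ≠ 0) (hq : (k - 1) ^ 3 < Fintype.card F)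
    {a : F} (ha : a ≠ 0) : ∃ x y z : F, x ^ k + y ^ k + z ^ k = a := by
  have hsmall :
      ‖addConv (torsionCharSum F k) (addConv (torsionCharSum F k) (torsionCharSum F k)) a‖
        < ‖(Fintype.card F : ℂ) ^ 2‖ := by
    have : (0 : ℝ) < Fintype.card F := Nat.cast_pos.2 Fintype.card_pos
    calc _ ≤ ((k - 1 : ℕ) : ℝ) ^ 3 * Fintype.card F := norm_addConv_addConv_torsionCharSum_le hk ha
      _ < Fintype.card F * Fintype.card F := by gcongr; exact_mod_cast hq
      _ = ‖(Fintype.card F : ℂ) ^ 2‖ := by rw [norm_pow, Complex.norm_natCast, sq]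
  have hcount : addConv (fun y => 1 + torsionCharSum F k y)
      (addConv (fun y => 1 + torsionCharSum F k y) fun y => 1 + torsionCharSum F k y) a ≠ 0 := by
    rw [addConv_addConv_one_add_torsionCharSum]
    exact fun h => hsmall.ne' (by rw [eq_neg_of_add_eq_zero_left h, norm_neg])
  obtain ⟨u, _, rfl, hu, hvw⟩ := exists_add_eq_of_addConv_ne_zero hcount
  obtain ⟨v, w, rfl, hv, hw⟩ := exists_add_eq_of_addConv_ne_zero hvw
  obtain ⟨x, rfl⟩ := exists_pow_eq_of_one_add_torsionCharSum_ne_zero hk hu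
  obtain ⟨y, rfl⟩ := exists_pow_eq_of_one_add_torsionCharSum_ne_zero hk hv
  obtain ⟨z, rfl⟩ := exists_pow_eq_of_one_add_torsionCharSum_ne_zero hk hw
  exact ⟨z, y, x, rfl⟩

theorem exists_ne_zero_pow_add_pow_add_pow_eq {k : ℕ} (hk : k ≠ 0)
    (hq : (k - 1) ^ 3 < Fintype.card F) {a : F} (ha : a ≠ 0) :
    ∃ x y z : F, x ≠ 0 ∧ x ^ k + y ^ k + z ^ k = a := by
  obtain ⟨x, y, z, h⟩ := exists_pow_add_pow_add_pow_eq hk hq ha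
  by_cases hx : x = 0
  · by_cases hy : y = 0
    · have hz : z ≠ 0 := by
        rintro rfl
        simp [hx, hy, hk, ha.symm] at h
      exact ⟨z, y, x, hz, by linear_combination h⟩
    · exact ⟨y, x, z, hy, by linear_combination h⟩
  · exact ⟨x, y, z, hx, h⟩

theorem exists_pow_add_pow_eq_neg_one {k : ℕ} (hk : k ≠ 0) (hq : (k - 1) ^ 3 < Fintype.card F)
    (h1 : ∀ x : F, x ≠ 0 → x ^ k = 1) : ∃ y z : F, y ^ k + z ^ k = -1 := by
  obtain ⟨x, y, z, hx, h⟩ := exists_ne_zero_pow_add_pow_add_pow_eq (F := F) hk hq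
    (neg_ne_zero.2 one_ne_zero)
  by_cases hy : y = 0
  · exact ⟨x, z, by rwa [hy, zero_pow hk, add_zero] at h⟩
  by_cases hz : z = 0
  · exact ⟨x, y, by rwa [hz, zero_pow hk, add_zero] at h⟩
  rw [h1 x hx, h1 y hy, h1 z hz] at h
  have h2 : (2 : F) = 0 := pow_eq_zero_iff two_ne_zero |>.1 (by linear_combination h)
  exact ⟨1, 0, by rw [one_pow, zero_pow hk]; linear_combination h2⟩

theorem exists_four_pow_sum_eq {k : ℕ} (hk : k ≠ 0) (hq : (k - 1) ^ 3 < Fintype.card F) (t : F) :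
    ∃ x y z w : F, x ≠ 0 ∧ w ≠ 0 ∧ x ^ k + y ^ k + z ^ k + w ^ k = t := by
  by_cases hpow : ∃ w : F, w ≠ 0 ∧ w ^ k ≠ t
  · obtain ⟨w, hw, hwt⟩ := hpow
    obtain ⟨x, y, z, hx, h⟩ := exists_ne_zero_pow_add_pow_add_pow_eq hk hq (sub_ne_zero.2 hwt.symm)
    exact ⟨x, y, z, w, hx, hw, by rw [h, sub_add_cancel]⟩
  · push Not at hpow
    obtain rfl : 1 = t := by simpa using hpow 1 one_ne_zero
    obtain ⟨y, z, h⟩ := exists_pow_add_pow_eq_neg_one hk hq hpow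
    exact ⟨1, y, z, 1, one_ne_zero, one_ne_zero, by rw [one_pow]; linear_combination h⟩

end PowerSums

section Roots

open Polynomial

theorem exists_pow_eq_of_isNilpotent_sub {R : Type*} [CommRing R] {k : ℕ} (hk : IsUnit (k : R))
    {x a : R} (hx : IsUnit x) (h : IsNilpotent (x ^ k - a)) : ∃ y, y ^ k = a := by
  let P : R[X] := X ^ k - C a
  have hP : IsNilpotent (aeval x P) := by simpa [P] using h
  have hP' : IsUnit (aeval x (derivative P)) := by
    simpa [P, derivative_X_pow] using And.intro hk (hx.pow (k - 1))
  obtain ⟨y, ⟨-, hy⟩, -⟩ := existsUnique_nilpotent_sub_and_aeval_eq_zero hP hP'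
  exact ⟨y, by simpa [P, sub_eq_zero] using hy⟩

theorem exists_prod_dvd_pow_sub {R ι : Type*} [CommRing R] {k : ℕ} {a : R} {s : Finset ι}
    {f : ι → R} (hf : (s : Set ι).Pairwise (Function.onFun IsCoprime f))
    (h : ∀ i ∈ s, ∃ r, f i ∣ r ^ k - a) : ∃ r, ∏ i ∈ s, f i ∣ r ^ k - a := by
  choose! r hr using h
  have hcop : Pairwise (Function.onFun IsCoprime fun i : s => Ideal.span {f i}) :=
    fun i j hij => (Ideal.isCoprime_span_singleton_iff _ _).2
      (hf i.2 j.2 (Subtype.coe_injective.ne hij))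
  obtain ⟨t, ht⟩ := Ideal.exists_forall_sub_mem_ideal hcop fun i : s => r i
  refine ⟨t, Finset.prod_dvd_of_coprime hf fun i hi => ?_⟩
  have hdvd : f i ∣ t ^ k - r i ^ k :=
    (Ideal.mem_span_singleton.1 (ht ⟨i, hi⟩)).trans (sub_dvd_pow_sub_pow t (r i) k)
  simpa using hdvd.add (hr i hi)

variable {F : Type*} [Field F] {k : ℕ}

theorem exists_X_sub_C_pow_dvd_pow_sub_X (hk : (k : F) ≠ 0) {m : F} (hm : m ^ k ≠ 0) (e : ℕ) :
    ∃ r : F[X], (X - C (m ^ k)) ^ e ∣ r ^ k - X := by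
  let I : Ideal F[X] := Ideal.span {(X - C (m ^ k)) ^ e}
  have hk0 : k ≠ 0 := fun h => hk (by rw [h, Nat.cast_zero])
  have hkI : IsUnit (k : F[X] ⧸ I) := by
    simpa using (IsUnit.mk0 (k : F) hk).map (algebraMap F (F[X] ⧸ I))
  have hmI : IsUnit (Ideal.Quotient.mk I (C m)) :=
    ((IsUnit.mk0 m ((pow_ne_zero_iff hk0).1 hm)).map C).map _
  have hnil : IsNilpotent (Ideal.Quotient.mk I (C m) ^ k - Ideal.Quotient.mk I X) := by
    refine ⟨e, ?_⟩
    rw [← map_pow, ← map_pow, ← map_sub, ← map_pow, Ideal.Quotient.eq_zero_iff_dvd,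
      ← neg_sub X]
    exact pow_dvd_pow_of_dvd (dvd_neg.2 dvd_rfl) e
  obtain ⟨y, hy⟩ := exists_pow_eq_of_isNilpotent_sub hkI hmI hnil
  obtain ⟨r, rfl⟩ := Ideal.Quotient.mk_surjective y
  have hr : Ideal.Quotient.mk I (r ^ k - X) = 0 := by rw [map_sub, map_pow, hy, sub_self]
  exact ⟨r, Ideal.mem_span_singleton.1 (Ideal.Quotient.eq_zero_iff_mem.1 hr)⟩

theorem exists_prod_X_sub_C_dvd_pow_sub_X {ι : Type*} [Fintype ι] (hk : (k : F) ≠ 0) {m : ι → F}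
    (hm : {i | m i = 0}.Subsingleton) : ∃ r : F[X], ∏ i, (X - C (m i ^ k)) ∣ r ^ k - X := by
  classical
  have hk0 : k ≠ 0 := fun h => hk (by rw [h, Nat.cast_zero])
  rw [Finset.prod_comp (fun c => X - C c) fun i => m i ^ k]
  refine exists_prod_dvd_pow_sub (fun c _ d _ hcd =>
    (pairwise_coprime_X_sub_C Function.injective_id hcd).pow) fun c hc => ?_
  obtain ⟨i, -, rfl⟩ := Finset.mem_image.1 hc
  by_cases hi : m i ^ k = 0
  · have hle : (Finset.univ.filter fun j => m j ^ k = m i ^ k).card ≤ 1 :=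
      Finset.card_le_one.2 fun a ha b hb => hm
        (by simpa [hi, hk0] using ha) (by simpa [hi, hk0] using hb)
    refine ⟨0, (pow_dvd_pow _ hle).trans ?_⟩
    rw [hi, C_0, sub_zero, pow_one, zero_pow hk0, zero_sub]
    exact dvd_neg.2 dvd_rfl
  · exact exists_X_sub_C_pow_dvd_pow_sub_X hk hi _

variable {ι : Type*} [Fintype ι] [LinearOrder ι]

theorem exists_pow_eq_of_isUpperTriangular (hk : (k : F) ≠ 0) {M : Matrix ι ι F}
    (hM : M.IsUpperTriangular) {m : ι → F} (hm : {i | m i = 0}.Subsingleton)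
    (hdiag : ∀ i, M i i = m i ^ k) : ∃ B : Matrix ι ι F, B ^ k = M := by
  obtain ⟨r, hr⟩ := exists_prod_X_sub_C_dvd_pow_sub_X hk hm
  have hchar : M.charpoly ∣ r ^ k - X := by
    simpa only [Matrix.charpoly_of_isUpperTriangular M hM, hdiag] using hr
  have hzero := zero_dvd_iff.1 (M.aeval_self_charpoly ▸ map_dvd (aeval M) hchar)
  exact ⟨aeval M r, by simpa [sub_eq_zero] using hzero⟩

theorem exists_eq_pow_add_pow_of_diag_eq (hk : (k : F) ≠ 0) {A : Matrix ι ι F} {β γ : ι → F}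
    (hβ : {i | β i = 0}.Subsingleton) (hγ : {i | γ i = 0}.Subsingleton)
    (hA : ∀ i, A i i = β i ^ k + γ i ^ k) : ∃ B C : Matrix ι ι F, A = B ^ k + C ^ k := by
  let U : Matrix ι ι F :=
    Matrix.of fun i j => if i < j then A i j else if i = j then γ i ^ k else 0
  have hU : U.IsUpperTriangular := fun i j (hij : j < i) => by simp [U, hij.not_gt, hij.ne']
  have hL : (A - U).transpose.IsUpperTriangular := fun i j (hij : j < i) => by simp [U, hij]
  obtain ⟨B, hB⟩ := exists_pow_eq_of_isUpperTriangular hk hL hβ fun i => by simp [U, hA]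
  obtain ⟨C, hC⟩ := exists_pow_eq_of_isUpperTriangular hk hU hγ fun i => by simp [U]
  exact ⟨B.transpose, C, by rw [← Matrix.transpose_pow, hB, hC, Matrix.transpose_transpose,
    sub_add_cancel]⟩

end Roots

section PrescribedDiagonal

theorem exists_linearEquiv_apply_eq {K V κ : Type*} [DivisionRing K] [AddCommGroup V] [Module K V]
    [FiniteDimensional K V] {v w : κ → V} (hv : LinearIndependent K v)
    (hw : LinearIndependent K w) : ∃ e : V ≃ₗ[K] V, ∀ i, e (v i) = w i := by
  have hcoe {u : κ → V} (hu : LinearIndependent K u) (i : κ) :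
      (hu.linearCombinationEquiv (Finsupp.single i 1) : V) = u i := by
    rw [hu.linearCombinationEquiv_apply_coe, Finsupp.linearCombination_single, one_smul]
  obtain ⟨e, he⟩ := Submodule.exists_linearEquiv_restrict_eq
    (hv.linearCombinationEquiv.symm.trans hw.linearCombinationEquiv)
  refine ⟨e, fun i => ?_⟩
  rw [← hcoe hv, ← he, LinearEquiv.trans_apply, LinearEquiv.symm_apply_apply, hcoe hw]

theorem trace_eq_of_isConj {R ι : Type*} [CommSemiring R] [Fintype ι] [DecidableEq ι]
    {A B : Matrix ι ι R} (h : IsConj A B) : A.trace = B.trace := by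
  obtain ⟨P, hP⟩ := h
  rw [← Matrix.trace_units_conj P A, hP.eq, Units.mul_inv_cancel_right]

theorem exists_eq_pow_add_pow_of_isConj {R : Type*} [Semiring R] {a b : R} {k : ℕ}
    (hab : IsConj a b) (hb : ∃ c d : R, b = c ^ k + d ^ k) : ∃ c d : R, a = c ^ k + d ^ k := by
  obtain ⟨u, hu⟩ := hab
  obtain ⟨c, d, rfl⟩ := hb
  refine ⟨↑u⁻¹ * c * u, ↑u⁻¹ * d * u, ?_⟩
  rw [Units.conj_pow', Units.conj_pow', ← add_mul, ← mul_add, mul_assoc, ← hu.eq,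
    Units.inv_mul_cancel_left]

variable {F ι : Type*} [Field F] [DecidableEq ι]

theorem nontrivial_of_forall_ne_smul_one {A : Matrix ι ι F} (hA : ∀ a : F, A ≠ a • 1) :
    Nontrivial ι := by
  by_contra h
  rw [not_nontrivial_iff_subsingleton] at h
  rcases isEmpty_or_nonempty ι with _ | ⟨⟨i⟩⟩
  · exact hA 0 (Subsingleton.elim _ _)
  · refine hA (A i i) (Matrix.ext fun j l => ?_)
    simp [Subsingleton.elim j i, Subsingleton.elim l i]

theorem linearIndependent_pair_single_one_sub [Nontrivial ι] (i : ι) :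
    LinearIndependent F ![(Pi.single i 1 : ι → F), 1 - Pi.single i 1] := by
  obtain ⟨j, hj⟩ := exists_ne i
  refine LinearIndependent.pair_iff.2 fun s t h => ⟨?_, ?_⟩
  · simpa using congrFun h i
  · simpa [hj] using congrFun h j

variable [Fintype ι]

theorem exists_linearIndependent_pair_mulVec {A : Matrix ι ι F} (hA : ∀ a : F, A ≠ a • 1) :
    ∃ v, LinearIndependent F ![v, A.mulVec v] := by
  by_contra! h
  obtain ⟨a, ha⟩ := LinearMap.exists_eq_smul_id_of_forall_notLinearIndependent
    (f := Matrix.toLin' A) h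
  exact hA a (Matrix.toLin'.injective (by rw [ha, map_smul, Matrix.toLin'_one]; rfl))

theorem exists_isConj_mulVec_eq {A : Matrix ι ι F} {v x y : ι → F}
    (hv : LinearIndependent F ![v, A.mulVec v]) (hxy : LinearIndependent F ![x, y]) :
    ∃ M, IsConj A M ∧ M.mulVec x = y := by
  obtain ⟨e, he⟩ := exists_linearEquiv_apply_eq hv hxy
  let P : (Matrix ι ι F)ˣ := Units.mapEquiv LinearMap.toMatrixAlgEquiv'.toMulEquiv
    (LinearMap.GeneralLinearGroup.ofLinearEquiv e)
  have hP (u : ι → F) : (P : Matrix ι ι F).mulVec u = e u :=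
    LinearMap.toMatrix'_mulVec (e : (ι → F) →ₗ[F] ι → F) u
  have hPx : (P : Matrix ι ι F).mulVec v = x := (hP v).trans (he 0)
  refine ⟨(P : Matrix ι ι F) * A * (P⁻¹ : (Matrix ι ι F)ˣ), ⟨P, P.mk_semiconjBy A⟩, ?_⟩
  rw [← hPx, Matrix.mulVec_mulVec, Units.inv_mul_cancel_right, ← Matrix.mulVec_mulVec, hP]
  exact he 1

theorem exists_isConj_col_eq_one {A : Matrix ι ι F} (hA : ∀ a : F, A ≠ a • 1) (i : ι) :
    ∃ M, IsConj A M ∧ ∀ j ≠ i, M j i = 1 := by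
  have := nontrivial_of_forall_ne_smul_one hA
  obtain ⟨v, hv⟩ := exists_linearIndependent_pair_mulVec hA
  obtain ⟨M, hAM, hM⟩ := exists_isConj_mulVec_eq hv (linearIndependent_pair_single_one_sub i)
  refine ⟨M, hAM, fun j hj => ?_⟩
  simpa [hj] using congrFun hM j

theorem exists_isConj_diag_eq_of_ne {M : Matrix ι ι F} {i : ι} (hM : ∀ j ≠ i, M j i = 1)
    (d : ι → F) : ∃ N, IsConj M N ∧ ∀ j ≠ i, N j j = d j := by
  let t : ι → F := fun j => if j = i then 0 else M j j - d j
  -- Conjugation by the unipotent `1 + E` changes the `j`-th diagonal entry by `-M j i * t j`.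
  let E : Matrix ι ι F := Matrix.vecMulVec (Pi.single i 1) t
  have hE : E * E = 0 := by
    simp [E, Matrix.vecMulVec_mul_vecMulVec, t]
  let P : (Matrix ι ι F)ˣ :=
    ⟨1 + E, 1 - E, by simp [mul_sub, add_mul, hE], by simp [mul_add, sub_mul, hE]⟩
  refine ⟨(P : Matrix ι ι F) * M * (P⁻¹ : (Matrix ι ι F)ˣ), ⟨P, P.mk_semiconjBy M⟩, fun j hj => ?_⟩
  have hEj (B : Matrix ι ι F) : (E * B) j j = 0 := by
    simp [E, Matrix.vecMulVec_mul, Matrix.vecMulVec_apply, hj]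
  have hBE : (M * E) j j = M j j - d j := by
    simp [E, Matrix.mul_vecMulVec, Matrix.vecMulVec_apply, hM j hj, t, hj]
  calc ((1 + E) * M * (1 - E)) j j = M j j + (E * M) j j - (M * E) j j
        - (E * (M * E)) j j := by
        simp only [add_mul, mul_sub, one_mul, mul_one, mul_assoc,
          Matrix.add_apply, Matrix.sub_apply]
        ring
    _ = d j := by rw [hEj, hEj, hBE]; ring

theorem exists_isConj_diag_eq {A : Matrix ι ι F} (hA : ∀ a : F, A ≠ a • 1) {d : ι → F}
    (hd : ∑ i, d i = A.trace) : ∃ M, IsConj A M ∧ ∀ i, M i i = d i := by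
  obtain ⟨i⟩ := (nontrivial_of_forall_ne_smul_one hA).to_nonempty
  obtain ⟨M, hAM, hM⟩ := exists_isConj_col_eq_one hA i
  obtain ⟨N, hMN, hN⟩ := exists_isConj_diag_eq_of_ne hM d
  have hAN := hAM.trans hMN
  refine ⟨N, hAN, fun j => ?_⟩
  rcases eq_or_ne j i with rfl | hj
  · have hsum : ∑ l, (N l l - d l) = 0 := by
      rw [Finset.sum_sub_distrib, hd, trace_eq_of_isConj hAN]
      exact sub_self _
    rwa [Fintype.sum_eq_single j fun l hl => sub_eq_zero.2 (hN l hl), sub_eq_zero] at hsum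
  · exact hN j hj

end PrescribedDiagonal

section FiniteField

variable {F : Type*} [Field F] [Fintype F] {k : ℕ}

theorem exists_sum_pow_add_pow_eq {ι : Type*} [Fintype ι] [Nontrivial ι] (hk : k ≠ 0)
    (hq : (k - 1) ^ 3 < Fintype.card F) (t : F) :
    ∃ β γ : ι → F, {i | β i = 0}.Subsingleton ∧ {i | γ i = 0}.Subsingleton ∧
      ∑ i, (β i ^ k + γ i ^ k) = t := by
  classical
  obtain ⟨i, j, hij⟩ := exists_pair_ne ι
  obtain ⟨x, y, z, w, hx, hw, h⟩ := exists_four_pow_sum_eq hk hq (t - 2 * Fintype.card ι + 4)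
  let β : ι → F := Function.update (Function.update 1 j y) i x
  let γ : ι → F := Function.update (Function.update 1 j w) i z
  have hβ : {l | β l = 0} ⊆ {j} := fun l hl => by
    by_contra hlj
    by_cases hli : l = i <;> simp_all [β]
  have hγ : {l | γ l = 0} ⊆ {i} := fun l hl => by
    by_contra hli
    by_cases hlj : l = j <;> simp_all [γ]
  refine ⟨β, γ, Set.subsingleton_singleton.anti hβ, Set.subsingleton_singleton.anti hγ, ?_⟩
  have hsum : ∑ l, (β l ^ k + γ l ^ k - 2) = (x ^ k + z ^ k - 2) + (y ^ k + w ^ k - 2) := by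
    rw [Fintype.sum_eq_add i j hij]
    · simp [β, γ, hij.symm]
    · rintro l ⟨hli, hlj⟩
      simp only [β, γ, Function.update_of_ne hli, Function.update_of_ne hlj, Pi.one_apply, one_pow]
      norm_num
  rw [Finset.sum_sub_distrib, Finset.sum_const, Finset.card_univ, nsmul_eq_mul] at hsum
  linear_combination hsum + h

theorem exists_eq_pow_add_pow_of_forall_ne_smul_one {ι : Type*} [Fintype ι] [LinearOrder ι]
    (hk : (k : F) ≠ 0) (hq : (k - 1) ^ 3 < Fintype.card F) {A : Matrix ι ι F}
    (hA : ∀ a : F, A ≠ a • 1) : ∃ B C : Matrix ι ι F, A = B ^ k + C ^ k := by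
  have hk0 : k ≠ 0 := fun h => hk (by rw [h, Nat.cast_zero])
  have := nontrivial_of_forall_ne_smul_one hA
  obtain ⟨β, γ, hβ, hγ, hsum⟩ := exists_sum_pow_add_pow_eq (ι := ι) hk0 hq A.trace
  obtain ⟨M, hAM, hM⟩ := exists_isConj_diag_eq hA hsum
  exact exists_eq_pow_add_pow_of_isConj hAM (exists_eq_pow_add_pow_of_diag_eq hk hβ hγ hM)

theorem exists_smul_one_eq_pow_add_pow {n : ℕ} (hn : 2 ≤ n) (hk : k ≠ 0)
    (hq : (k - 1) ^ 3 < Fintype.card F) (a : F) :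
    ∃ B C : Matrix (Fin n) (Fin n) F, a • 1 = B ^ k + C ^ k := by
  rcases eq_or_ne a 0 with rfl | ha
  · exact ⟨0, 0, by rw [zero_smul, zero_pow hk, add_zero]⟩
  obtain ⟨p, _⟩ := CharP.exists F
  have : Fact p.Prime := ⟨CharP.char_is_prime F p⟩
  have : NeZero n := ⟨by lia⟩
  let K := FiniteField.Extension F p n
  have : Fintype K := Fintype.ofFinite K
  have hK : (k - 1) ^ 4 < Fintype.card K :=
    calc (k - 1) ^ 4 = (k - 1) ^ 3 * (k - 1) := pow_succ _ _
      _ ≤ (k - 1) ^ 3 * (k - 1) ^ 3 := by gcongr; exact Nat.le_self_pow three_ne_zero _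
      _ < Fintype.card F * Fintype.card F := by gcongr
      _ = Fintype.card F ^ 2 := (sq _).symm
      _ ≤ Fintype.card F ^ n := Nat.pow_le_pow_right Fintype.card_pos hn
      _ = Fintype.card K := by
        rw [← Nat.card_eq_fintype_card, ← Nat.card_eq_fintype_card,
          FiniteField.natCard_extension]
  obtain ⟨x, y, hxy⟩ := exists_pow_add_pow_eq hk hK ((map_ne_zero (algebraMap F K)).2 ha)
  let b : Module.Basis (Fin n) F K :=
    Module.finBasisOfFinrankEq F K (FiniteField.finrank_extension F p n)
  refine ⟨Algebra.leftMulMatrix b x, Algebra.leftMulMatrix b y, ?_⟩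
  rw [← map_pow, ← map_pow, ← map_add, hxy, AlgHom.commutes, Algebra.algebraMap_eq_smul_one]

end FiniteField

theorem corollary1p9 {F : Type*} [Field F] [Fintype F] (p : ℕ) [Fact p.Prime] [CharP F p]
    (k n : ℕ) (hn : 2 ≤ n) (hpk : ¬ p ∣ k)
    (hq : (k : ℤ) ^ 3 - 3 * (k : ℤ) ^ 2 + 3 * (k : ℤ) ≤ (Fintype.card F : ℤ))
    (A : Matrix (Fin n) (Fin n) F) :
    ∃ B C : Matrix (Fin n) (Fin n) F, A = B ^ k + C ^ k := by
  have hkF : (k : F) ≠ 0 := by rwa [Ne, CharP.cast_eq_zero_iff F p]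
  have hk : k ≠ 0 := fun h => hkF (by rw [h, Nat.cast_zero])
  have hcard : (k - 1) ^ 3 < Fintype.card F := by
    zify [Nat.one_le_iff_ne_zero.2 hk]
    linarith
  by_cases hA : ∃ a : F, A = a • 1
  · obtain ⟨a, rfl⟩ := hA
    exact exists_smul_one_eq_pow_add_pow hn hk hcard a
  · push Not at hA
    exact exists_eq_pow_add_pow_of_forall_ne_smul_one hkF hcard hA
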